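/- Fix the unary operators $\{\neg,\mathbf{X},\mathbf{F},\mathbf{G}\}$, the binary temporal operators $\{\mathbf{U},\mathbf{R},\mathbf{W},\mathbf{M}\}$ and the ten binary logical operators $\lor,\land,\Rightarrow,\Leftarrow,\Leftrightarrow$ and their negations. Let $U^t$, $B^t$, $B^l$ be arbitrary subsets of these three sets, and let $n\in\mathbb{N}\cup\{\infty\}$. For a logic $L$ among $\mathrm{LTL}$, $\mathrm{CTL}$, $\mathrm{ATL}^k$ ($k\ge 1$ agents), the decision problem $L_{\mathrm{Learn}}(U^t,B^t,B^l,n)$ is the following. The input is $(\mathrm{Prop},\mathcal{P},\mathcal{N},B)$, where $\mathrm{Prop}$ is a finite non-empty set of propositions, $\mathcal{P},\mathcal{N}$ are finite sets of models of $L$ over $\mathrm{Prop}$, and $B\in\mathbb{N}$ is written in unary. The models are ultimately periodic words $u\cdot v^\omega$ over $2^{\mathrm{Prop}}$, presented by $u$ and $v\neq\varepsilon$, for $\mathrm{LTL}$; finite Kripke structures (with a set of initial states and at least one successor for each state) for $\mathrm{CTL}$; and finite concurrent game structures with $k$ agents and a set of initial states for $\mathrm{ATL}^k$. A structure satisfies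 a formula when all its initial states do. The question is whether there is an $L$-formula $\varphi$ over $\mathrm{Prop}$ which uses only operators in $U^t\cup B^t\cup B^l$ (in $\mathrm{CTL}$, each temporal operator is immediately preceded by a path quantifier $\exists$ or $\forall$; in $\mathrm{ATL}^k$, by a strategic quantifier $\langle\!\langle A\rangle\!\rangle$ for a set $A$ of agents), which has at most $B$ distinct sub-formulas, at most $n$ of which have a binary main operator, and which is satisfied by all models in $\mathcal{P}$ and by no model in $\mathcal{N}$. Then $\mathrm{CTL}_{\mathrm{Learn}}(U^t,B^t,B^l,n)$ is at least as hard as $\mathrm{LTL}_{\mathrm{Learn}}(U^t,B^t,B^l,n)$ under logarithmic-space many-one reductions. More precisely, the map that keeps $\mathrm{Prop}$ and $B$ and replaces each word $w=u\cdot v^\omega$ in $\mathcal{P}$ and $\mathcal{N}$ by the lasso-shaped Kripke structure $K_w$ is such a reduction; here $K_w$ has one state for each position of $u\cdot v$, labelled by the letter at this position, its only initial state is the first one, each state but the last has the next one as its only successor, and the last state has the state of the first letter of $v$ as its only successor. Moreover, for every $k\ge 1$, $\mathrm{ATL}^k_{\mathrm{Learn}}(U^t,B^t,B^l,n)$ is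 at least as hard as $\mathrm{LTL}_{\mathrm{Learn}}(U^t,B^t,B^l,n)$ under logarithmic-space many-one reductions. -/

import Mathlib

namespace LearnTL

/-! ### Operators -/

/-- Unary temporal operators `X`, `F`, `G`. -/
inductive TempUn
  | X | F | G
  deriving DecidableEq

/-- All unary operators: negation and the unary temporal operators. -/
inductive UnOp
  | neg
  | temp (t : TempUn)
  deriving DecidableEq

/-- Binary temporal operators: until, release, weak until, mighty release. -/
inductive TempBin
  | U | R | W | M
  deriving DecidableEq

/-- Binary logical operators and their negations. -/
inductive LogBin
  | or | and | imp | revImp | iff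
  | nor | nand | nimp | nrevImp | niff
  deriving DecidableEq

/-- Truth of `t φ` along a sequence, where `P i` is the truth of `φ` on its `i`-th suffix. -/
def TempUn.Holds : TempUn → (ℕ → Prop) → Prop
  | .X, P => P 1
  | .F, P => ∃ i, P i
  | .G, P => ∀ i, P i

/-- Truth of `φ₁ U φ₂` along a sequence. -/
def UntilHolds (P Q : ℕ → Prop) : Prop := ∃ i, Q i ∧ ∀ j < i, P j

/-- Truth of `φ₁ t φ₂` along a sequence. -/
def TempBin.Holds : TempBin → (ℕ → Prop) → (ℕ → Prop) → Prop
  | .U, P, Q => UntilHolds P Q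
  | .R, P, Q => ¬ UntilHolds (fun i => ¬ P i) (fun i => ¬ Q i)
  | .W, P, Q => UntilHolds P Q ∨ ∀ i, P i
  | .M, P, Q => ¬ UntilHolds (fun i => ¬ P i) (fun i => ¬ Q i) ∧ ∃ i, P i

def LogBin.Holds : LogBin → Prop → Prop → Prop
  | .or, a, b => a ∨ b
  | .and, a, b => a ∧ b
  | .imp, a, b => a → b
  | .revImp, a, b => b → a
  | .iff, a, b => a ↔ b
  | .nor, a, b => ¬ (a ∨ b)
  | .nand, a, b => ¬ (a ∧ b)
  | .nimp, a, b => ¬ (a → b)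
  | .nrevImp, a, b => ¬ (b → a)
  | .niff, a, b => ¬ (a ↔ b)

/-! ### LTL. The set of propositions is `Fin p`. -/

inductive LTL (p : ℕ)
  | atom (x : Fin p)
  | neg (φ : LTL p)
  | tempUn (t : TempUn) (φ : LTL p)
  | tempBin (t : TempBin) (φ ψ : LTL p)
  | logBin (b : LogBin) (φ ψ : LTL p)
  deriving DecidableEq

namespace LTL

variable {p : ℕ}

/-- The formula only uses operators among the allowed ones. -/
def InFragment (Ut : Set UnOp) (Bt : Set TempBin) (Bl : Set LogBin) : LTL p → Prop
  | atom _ => True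
  | neg φ => UnOp.neg ∈ Ut ∧ InFragment Ut Bt Bl φ
  | tempUn t φ => UnOp.temp t ∈ Ut ∧ InFragment Ut Bt Bl φ
  | tempBin t φ ψ => t ∈ Bt ∧ InFragment Ut Bt Bl φ ∧ InFragment Ut Bt Bl ψ
  | logBin b φ ψ => b ∈ Bl ∧ InFragment Ut Bt Bl φ ∧ InFragment Ut Bt Bl ψ

def subF : LTL p → Finset (LTL p)
  | atom x => {atom x}
  | neg φ => insert (neg φ) (subF φ)
  | tempUn t φ => insert (tempUn t φ) (subF φ)
  | tempBin t φ ψ => insert (tempBin t φ ψ) (subF φ ∪ subF ψ)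
  | logBin b φ ψ => insert (logBin b φ ψ) (subF φ ∪ subF ψ)

/-- The main operator is binary. -/
def isBin : LTL p → Bool
  | tempBin _ _ _ => true
  | logBin _ _ _ => true
  | _ => false

/-- Number of distinct sub-formulas. -/
def size (φ : LTL p) : ℕ := φ.subF.card

/-- Number of distinct sub-formulas whose main operator is binary. -/
def nbBin (φ : LTL p) : ℕ := (φ.subF.filter fun ψ => ψ.isBin = true).card

/-- `w ⊨ φ` for an infinite word `w`. -/
def Sat : (ℕ → Finset (Fin p)) → LTL p → Prop
  | w, atom x => x ∈ w 0
  | w, neg φ => ¬ Sat w φ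
  | w, tempUn t φ => t.Holds fun i => Sat (fun j => w (i + j)) φ
  | w, tempBin t φ ψ =>
      t.Holds (fun i => Sat (fun j => w (i + j)) φ) (fun i => Sat (fun j => w (i + j)) ψ)
  | w, logBin b φ ψ => b.Holds (Sat w φ) (Sat w ψ)

end LTL

/-- An ultimately periodic word, presented by `u` and `v` (standing for `u · v^ω`). -/
structure UPWord (p : ℕ) where
  u : List (Finset (Fin p))
  v : List (Finset (Fin p))
  v_ne_nil : v ≠ []

/-- The infinite word `u · v^ω`. -/
def UPWord.toSeq {p : ℕ} (w : UPWord p) (i : ℕ) : Finset (Fin p) :=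
  if i < w.u.length then w.u.getD i ∅ else w.v.getD ((i - w.u.length) % w.v.length) ∅

/-! ### Branching-time state formulas

`Qt` is the type of the quantifiers put in front of path formulas: `∃`, `∀` for CTL,
coalitions of agents for ATL. -/

inductive BForm (p : ℕ) (Qt : Type)
  | atom (x : Fin p)
  | neg (φ : BForm p Qt)
  | tempUn (A : Qt) (t : TempUn) (φ : BForm p Qt)
  | tempBin (A : Qt) (t : TempBin) (φ ψ : BForm p Qt)
  | logBin (b : LogBin) (φ ψ : BForm p Qt)
  deriving DecidableEq

namespace BForm

variable {p : ℕ} {Qt : Type}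

def InFragment (Ut : Set UnOp) (Bt : Set TempBin) (Bl : Set LogBin) : BForm p Qt → Prop
  | atom _ => True
  | neg φ => UnOp.neg ∈ Ut ∧ InFragment Ut Bt Bl φ
  | tempUn _ t φ => UnOp.temp t ∈ Ut ∧ InFragment Ut Bt Bl φ
  | tempBin _ t φ ψ => t ∈ Bt ∧ InFragment Ut Bt Bl φ ∧ InFragment Ut Bt Bl ψ
  | logBin b φ ψ => b ∈ Bl ∧ InFragment Ut Bt Bl φ ∧ InFragment Ut Bt Bl ψ

def subF [DecidableEq Qt] : BForm p Qt → Finset (BForm p Qt)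
  | atom x => {atom x}
  | neg φ => insert (neg φ) (subF φ)
  | tempUn A t φ => insert (tempUn A t φ) (subF φ)
  | tempBin A t φ ψ => insert (tempBin A t φ ψ) (subF φ ∪ subF ψ)
  | logBin b φ ψ => insert (logBin b φ ψ) (subF φ ∪ subF ψ)

def isBin : BForm p Qt → Bool
  | tempBin _ _ _ _ => true
  | logBin _ _ _ => true
  | _ => false

def size [DecidableEq Qt] (φ : BForm p Qt) : ℕ := φ.subF.card

def nbBin [DecidableEq Qt] (φ : BForm p Qt) : ℕ :=
  (φ.subF.filter fun ψ => ψ.isBin = true).card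

/-- Satisfaction at a state. `quant A q T` says that, from the state `q`, the quantifier `A`
makes the set `T` of infinite state sequences hold. -/
def Sat {Q : Type} (label : Q → Finset (Fin p)) (quant : Qt → Q → Set (ℕ → Q) → Prop) :
    BForm p Qt → Q → Prop
  | atom x, q => x ∈ label q
  | neg φ, q => ¬ Sat label quant φ q
  | tempUn A t φ, q => quant A q {ρ | t.Holds fun i => Sat label quant φ (ρ i)}
  | tempBin A t φ ψ, q => quant A q
      {ρ | t.Holds (fun i => Sat label quant φ (ρ i)) (fun i => Sat label quant ψ (ρ i))}
  | logBin b φ ψ, q => b.Holds (Sat label quant φ q) (Sat label quant ψ q)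

end BForm

/-! ### Kripke structures and CTL -/

structure Kripke (p : ℕ) where
  numStates : ℕ
  init : Finset (Fin numStates)
  label : Fin numStates → Finset (Fin p)
  succ : Fin numStates → Finset (Fin numStates)
  succ_nonempty : ∀ q, (succ q).Nonempty

inductive PathQuant
  | all | ex
  deriving DecidableEq

abbrev CTL (p : ℕ) := BForm p PathQuant

namespace Kripke

variable {p : ℕ}

/-- Infinite paths from `q`. -/
def Out (K : Kripke p) (q : Fin K.numStates) : Set (ℕ → Fin K.numStates) :=
  {ρ | ρ 0 = q ∧ ∀ i, ρ (i + 1) ∈ K.succ (ρ i)}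

def Quant (K : Kripke p) :
    PathQuant → Fin K.numStates → Set (ℕ → Fin K.numStates) → Prop
  | .all, q, T => ∀ ρ ∈ K.Out q, ρ ∈ T
  | .ex, q, T => ∃ ρ ∈ K.Out q, ρ ∈ T

/-- `K ⊨ φ`: all initial states satisfy `φ`. -/
def Models (K : Kripke p) (φ : CTL p) : Prop :=
  ∀ q ∈ K.init, φ.Sat K.label K.Quant q

end Kripke

/-! ### Concurrent game structures and ATL -/

/-- Concurrent game structures with agents `Fin k`; at state `q`, agent `a` chooses an action in
`Fin (d q a)`. -/
structure CGS (k p : ℕ) where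
  numStates : ℕ
  init : Finset (Fin numStates)
  label : Fin numStates → Finset (Fin p)
  d : Fin numStates → Fin k → ℕ
  d_pos : ∀ q a, 0 < d q a
  δ : (q : Fin numStates) → ((a : Fin k) → Fin (d q a)) → Fin numStates

abbrev ATL (k p : ℕ) := BForm p (Finset (Fin k))

namespace CGS

variable {k p : ℕ}

/-- A strategy of agent `a`: a non-empty history is given as its past followed by its last
(current) state, and is mapped to an action available to `a` at the current state. -/
def Strategy (C : CGS k p) (a : Fin k) : Type :=
  List (Fin C.numStates) → (q : Fin C.numStates) → Fin (C.d q a)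

/-- One strategy for each agent of the coalition `A`. -/
def Profile (C : CGS k p) (A : Finset (Fin k)) : Type :=
  (a : Fin k) → a ∈ A → C.Strategy a

/-- Successors of `q` when the agents of `A` play `α`. -/
def Succ (C : CGS k p) (A : Finset (Fin k)) (q : Fin C.numStates)
    (α : (a : Fin k) → a ∈ A → Fin (C.d q a)) : Set (Fin C.numStates) :=
  {q' | ∃ β : (a : Fin k) → Fin (C.d q a), (∀ a (h : a ∈ A), β a = α a h) ∧ C.δ q β = q'}

/-- Infinite paths from `q` compatible with the strategy profile `s`. -/
def Out (C : CGS k p) {A : Finset (Fin k)} (q : Fin C.numStates) (s : C.Profile A) :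
    Set (ℕ → Fin C.numStates) :=
  {ρ | ρ 0 = q ∧
    ∀ i, ρ (i + 1) ∈ C.Succ A (ρ i) fun a h => s a h ((List.range i).map ρ) (ρ i)}

def Quant (C : CGS k p) (A : Finset (Fin k)) (q : Fin C.numStates)
    (T : Set (ℕ → Fin C.numStates)) : Prop :=
  ∃ s : C.Profile A, ∀ ρ ∈ C.Out q s, ρ ∈ T

def Models (C : CGS k p) (φ : ATL k p) : Prop :=
  ∀ q ∈ C.init, φ.Sat C.label C.Quant q

end CGS

/-! ### Self-delimiting binary encodings -/

def encBool (b : Bool) : List Bool := [b]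

/-- Unary encoding `1ⁿ0`. -/
def encUnary (n : ℕ) : List Bool := List.replicate n true ++ [false]

/-- A list is encoded by writing `1` in front of each entry and `0` after the last one. -/
def encList {α : Type} (e : α → List Bool) : List α → List Bool
  | [] => [false]
  | a :: l => true :: (e a ++ encList e l)

/-- Binary encoding, least significant digit first. -/
def encBinary (n : ℕ) : List Bool := encList encBool n.bits

/-- A set of propositions is encoded by its characteristic bit vector. -/
def encLabel {p : ℕ} (a : Finset (Fin p)) : List Bool :=
  encList encBool (List.ofFn fun i : Fin p => decide (i ∈ a))

def UPWord.enc {p : ℕ} (w : UPWord p) : List Bool :=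
  encList encLabel w.u ++ encList encLabel w.v

/-- One row per state: whether it is initial, its label, the list of its successors. -/
def Kripke.table {p : ℕ} (K : Kripke p) : List (Bool × Finset (Fin p) × List ℕ) :=
  List.ofFn fun q => (decide (q ∈ K.init), K.label q,
    ((List.finRange K.numStates).filter fun q' => q' ∈ K.succ q).map Fin.val)

def Kripke.enc {p : ℕ} (K : Kripke p) : List Bool :=
  encList (fun r => encBool r.1 ++ (encLabel r.2.1 ++ encList encBinary r.2.2)) K.table

/-- One row per state: whether it is initial, its label, the number of actions of each agent,
and the list of the successors by all the action tuples, in (mixed radix) order. -/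
def CGS.table {k p : ℕ} (C : CGS k p) : List (Bool × Finset (Fin p) × List ℕ × List ℕ) :=
  List.ofFn fun q => (decide (q ∈ C.init), C.label q, List.ofFn (C.d q),
    List.ofFn fun j => (C.δ q (finPiFinEquiv.symm j)).val)

def CGS.enc {k p : ℕ} (C : CGS k p) : List Bool :=
  encList (fun r => encBool r.1 ++ (encLabel r.2.1 ++
    (encList encUnary r.2.2.1 ++ encList encBinary r.2.2.2))) C.table

/-! Unique decodability of these encodings. -/

/-- `e` is injective and no code word is a proper prefix of another one. -/
def SelfDelim {α : Type} (e : α → List Bool) : Prop :=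
  ∀ a b r s, e a ++ r = e b ++ s → a = b ∧ r = s

theorem SelfDelim.injective {α : Type} {e : α → List Bool} (h : SelfDelim e) :
    Function.Injective e := fun a b hab => (h a b [] [] (by rw [hab])).1

theorem SelfDelim.comp {α β : Type} {e : β → List Bool} (h : SelfDelim e) {g : α → β}
    (hg : Function.Injective g) : SelfDelim fun a => e (g a) := fun _ _ _ _ hab =>
  ⟨hg (h _ _ _ _ hab).1, (h _ _ _ _ hab).2⟩

theorem SelfDelim.prod {α β : Type} {e : α → List Bool} {f : β → List Bool} (he : SelfDelim e)
    (hf : SelfDelim f) : SelfDelim fun x : α × β => e x.1 ++ f x.2 := by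
  rintro ⟨a, b⟩ ⟨a', b'⟩ r s h
  simp only [List.append_assoc] at h
  obtain ⟨rfl, h₁⟩ := he _ _ _ _ h
  obtain ⟨rfl, h₂⟩ := hf _ _ _ _ h₁
  exact ⟨rfl, h₂⟩

theorem selfDelim_encBool : SelfDelim encBool := by
  intro a b r s h
  simpa [encBool] using h

theorem selfDelim_encList {α : Type} {e : α → List Bool} (he : SelfDelim e) :
    SelfDelim (encList e) := by
  intro a
  induction a with
  | nil => intro b r s h; cases b <;> simp_all [encList]
  | cons x a ih =>
    intro b r s h
    cases b with
    | nil => simp [encList] at h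
    | cons y b =>
      simp only [encList, List.cons_append, List.append_assoc, List.cons.injEq, true_and] at h
      obtain ⟨rfl, h₁⟩ := he _ _ _ _ h
      obtain ⟨rfl, h₂⟩ := ih _ _ _ h₁
      exact ⟨rfl, h₂⟩

theorem selfDelim_encUnary : SelfDelim encUnary := by
  intro a
  induction a with
  | zero => intro b r s h; cases b <;> simp_all [encUnary, List.replicate_succ]
  | succ a ih =>
    intro b r s h
    cases b with
    | zero => simp [encUnary, List.replicate_succ] at h
    | succ b =>
      obtain ⟨rfl, h₁⟩ := ih b r s (by simpa [encUnary, List.replicate_succ] using h)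
      exact ⟨rfl, h₁⟩

theorem selfDelim_encBinary : SelfDelim encBinary :=
  (selfDelim_encList selfDelim_encBool).comp fun a b h =>
    Nat.digits_inj_iff.1 (by rw [Nat.digits_two_eq_bits, Nat.digits_two_eq_bits, h] :
      Nat.digits 2 a = Nat.digits 2 b)

theorem selfDelim_encLabel {p : ℕ} : SelfDelim (encLabel (p := p)) :=
  (selfDelim_encList selfDelim_encBool).comp fun a b h => by
    ext i
    have := congrFun (List.ofFn_injective h) i
    simpa using this

theorem UPWord.selfDelim_enc {p : ℕ} : SelfDelim (UPWord.enc (p := p)) :=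
  ((selfDelim_encList selfDelim_encLabel).prod (selfDelim_encList selfDelim_encLabel)).comp
    (g := fun w : UPWord p => (w.u, w.v)) fun a b h => by
      cases a; cases b; simp_all

theorem Kripke.table_injective {p : ℕ} : Function.Injective (Kripke.table (p := p)) := by
  rintro ⟨n, i, l, s, hs⟩ ⟨n', i', l', s', hs'⟩ h
  obtain rfl : n = n' := by simpa [Kripke.table] using congrArg List.length h
  have h := fun q => congrFun (List.ofFn_injective h) q
  simp only [Prod.mk.injEq, decide_eq_decide] at h
  obtain rfl : i = i' := Finset.ext fun q => (h q).1
  obtain rfl : l = l' := funext fun q => (h q).2.1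
  obtain rfl : s = s' := by
    funext q
    ext x
    have := congrArg (fun L => x ∈ L) (List.map_injective_iff.2 Fin.val_injective (h q).2.2)
    simpa using this
  rfl

theorem Kripke.selfDelim_enc {p : ℕ} : SelfDelim (Kripke.enc (p := p)) :=
  (selfDelim_encList (selfDelim_encBool.prod
    (selfDelim_encLabel.prod (selfDelim_encList selfDelim_encBinary)))).comp
    Kripke.table_injective

theorem CGS.table_injective {k p : ℕ} : Function.Injective (CGS.table (k := k) (p := p)) := by
  rintro ⟨n, i, l, d, hd, δ⟩ ⟨n', i', l', d', hd', δ'⟩ h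
  obtain rfl : n = n' := by simpa [CGS.table] using congrArg List.length h
  have h := fun q => congrFun (List.ofFn_injective h) q
  simp only [Prod.mk.injEq, decide_eq_decide] at h
  obtain rfl : i = i' := Finset.ext fun q => (h q).1
  obtain rfl : l = l' := funext fun q => (h q).2.1
  obtain rfl : d = d' := funext fun q => List.ofFn_injective (h q).2.2.1
  obtain rfl : δ = δ' := by
    funext q α
    have := congrFun (List.ofFn_injective (h q).2.2.2) (finPiFinEquiv α)
    simpa [Fin.ext_iff] using this
  rfl

theorem CGS.selfDelim_enc {k p : ℕ} : SelfDelim (CGS.enc (k := k) (p := p)) :=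
  (selfDelim_encList (selfDelim_encBool.prod (selfDelim_encLabel.prod
    ((selfDelim_encList selfDelim_encUnary).prod (selfDelim_encList selfDelim_encBinary))))).comp
    CGS.table_injective

/-! ### Decision problems and logarithmic-space reductions -/

/-- A decision problem: instances, written as words over `{0,1}`, and the set of the positive
ones. -/
structure DecisionProblem where
  Inst : Type
  enc : Inst → List Bool
  enc_injective : Function.Injective enc
  Yes : Inst → Prop

inductive Dir
  | left | stay | right

/-- The symbols on the read-only input tape, which is delimited by end markers. -/
inductive InSym
  | leftEnd
  | bit (b : Bool)
  | rightEnd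

/-- Deterministic Turing machines with a two-way read-only input tape, finitely many one-way
infinite work tapes, and a write-only output tape. In one step a machine may append a word to the
output. The value `none` of `step` means that the machine halts. -/
structure Transducer where
  State : Type
  Work : Type
  [finState : Finite State]
  [finWork : Finite Work]
  blank : Work
  tapes : ℕ
  start : State
  step : State → InSym → (Fin tapes → Work) →
    Option (State × Dir × (Fin tapes → Work × Dir) × List Bool)

def Dir.move : Dir → ℕ → ℕ
  | .left, i => i - 1
  | .stay, i => i
  | .right, i => i + 1

/-- The symbol in cell `i` of the input tape: cell `0` holds the left end marker, and cells
`1, …, |x|` hold `x`. -/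
def inputAt (x : List Bool) : ℕ → InSym
  | 0 => .leftEnd
  | i + 1 => match x[i]? with
    | some b => .bit b
    | none => .rightEnd

namespace Transducer

structure Config (M : Transducer) where
  state : M.State
  inHead : ℕ
  head : Fin M.tapes → ℕ
  tape : Fin M.tapes → ℕ → M.Work
  out : List Bool

def initial (M : Transducer) : M.Config where
  state := M.start
  inHead := 0
  head := fun _ => 0
  tape := fun _ _ => M.blank
  out := []

/-- The next configuration on input `x`, or `none` if the machine has halted. The input head
stays within the end markers. -/
def next (M : Transducer) (x : List Bool) (c : M.Config) : Option M.Config :=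
  (M.step c.state (inputAt x c.inHead) fun t => c.tape t (c.head t)).map fun r =>
    { state := r.1
      inHead := min (r.2.1.move c.inHead) (x.length + 1)
      head := fun t => (r.2.2.1 t).2.move (c.head t)
      tape := fun t => Function.update (c.tape t) (c.head t) (r.2.2.1 t).1
      out := c.out ++ r.2.2.2 }

def Reaches (M : Transducer) (x : List Bool) : M.Config → M.Config → Prop :=
  Relation.ReflTransGen fun c c' => M.next x c = some c'

/-- On input `x` the machine halts with output `y`, and during the whole computation the heads
only visit the first `s` cells of each work tape. -/
def ComputesInSpace (M : Transducer) (x y : List Bool) (s : ℕ) : Prop :=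
  (∃ c, M.Reaches x M.initial c ∧ M.next x c = none ∧ c.out = y) ∧
    ∀ c, M.Reaches x M.initial c → ∀ t, c.head t < s

end Transducer

/-- `f` is a many-one reduction from `A` to `B` which a Turing machine computes in space
`O(log n)`. -/
def IsLogspaceReduction (A B : DecisionProblem) (f : A.Inst → B.Inst) : Prop :=
  (∀ I, A.Yes I ↔ B.Yes (f I)) ∧
    ∃ (M : Transducer) (c : ℕ), ∀ I,
      M.ComputesInSpace (A.enc I) (B.enc (f I)) (c * (Nat.log 2 (A.enc I).length + 1))

/-- `B` is at least as hard as `A` under logarithmic-space reductions. -/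
def LogspaceReducible (A B : DecisionProblem) : Prop :=
  ∃ f : A.Inst → B.Inst, IsLogspaceReduction A B f

/-! ### Learning problems -/

/-- Inputs of the learning problems: a non-empty set `Fin numProp` of propositions, finite sets of
positive and negative models (given as lists), and a bound on the size. -/
structure LearnInst (Model : ℕ → Type) where
  numProp : ℕ
  numProp_pos : 0 < numProp
  pos : List (Model numProp)
  neg : List (Model numProp)
  bound : ℕ

/-- The bound is written in unary. -/
def LearnInst.enc {Model : ℕ → Type} (e : ∀ p, Model p → List Bool) (I : LearnInst Model) :
    List Bool :=
  encUnary I.numProp ++ (encList (e _) I.pos ++ (encList (e _) I.neg ++ encUnary I.bound))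

theorem LearnInst.enc_injective {Model : ℕ → Type} {e : ∀ p, Model p → List Bool}
    (he : ∀ p, SelfDelim (e p)) : Function.Injective (LearnInst.enc e) := by
  rintro ⟨p, hp, P, N, B⟩ ⟨p', hp', P', N', B'⟩ h
  obtain ⟨h₀, h₁⟩ := selfDelim_encUnary _ _ _ _ h
  dsimp only at h₀
  subst h₀
  obtain ⟨rfl, h₂⟩ := selfDelim_encList (he _) _ _ _ _ h₁
  obtain ⟨rfl, h₃⟩ := selfDelim_encList (he _) _ _ _ _ h₂
  obtain rfl := selfDelim_encUnary.injective h₃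
  rfl

/-- `φ` accepts all the models in `pos` and rejects all those in `neg`. -/
def Separates {Model Form : Type} (sat : Model → Form → Prop) (pos neg : List Model)
    (φ : Form) : Prop :=
  (∀ X ∈ pos, sat X φ) ∧ ∀ X ∈ neg, ¬ sat X φ

def LTLLearn (Ut : Set UnOp) (Bt : Set TempBin) (Bl : Set LogBin) (n : ℕ∞) :
    DecisionProblem where
  Inst := LearnInst UPWord
  enc := LearnInst.enc fun _ => UPWord.enc
  enc_injective := LearnInst.enc_injective fun _ => UPWord.selfDelim_enc
  Yes I := ∃ φ : LTL I.numProp, φ.InFragment Ut Bt Bl ∧ φ.size ≤ I.bound ∧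
    (φ.nbBin : ℕ∞) ≤ n ∧ Separates (fun w φ => LTL.Sat w.toSeq φ) I.pos I.neg φ

def CTLLearn (Ut : Set UnOp) (Bt : Set TempBin) (Bl : Set LogBin) (n : ℕ∞) :
    DecisionProblem where
  Inst := LearnInst Kripke
  enc := LearnInst.enc fun _ => Kripke.enc
  enc_injective := LearnInst.enc_injective fun _ => Kripke.selfDelim_enc
  Yes I := ∃ φ : CTL I.numProp, φ.InFragment Ut Bt Bl ∧ φ.size ≤ I.bound ∧
    (φ.nbBin : ℕ∞) ≤ n ∧ Separates Kripke.Models I.pos I.neg φ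

def ATLLearn (k : ℕ) (Ut : Set UnOp) (Bt : Set TempBin) (Bl : Set LogBin) (n : ℕ∞) :
    DecisionProblem where
  Inst := LearnInst (CGS k)
  enc := LearnInst.enc fun _ => CGS.enc
  enc_injective := LearnInst.enc_injective fun _ => CGS.selfDelim_enc
  Yes I := ∃ φ : ATL k I.numProp, φ.InFragment Ut Bt Bl ∧ φ.size ≤ I.bound ∧
    (φ.nbBin : ℕ∞) ≤ n ∧ Separates CGS.Models I.pos I.neg φ

/-! ### The lasso of an ultimately periodic word -/

/-- The lasso-shaped Kripke structure of `u · v^ω`: one state per letter of `u` and of `v`, the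
first one being initial; each state leads to the next one, and the last one leads back to the
first letter of `v`. -/
def lasso {p : ℕ} (w : UPWord p) : Kripke p where
  numStates := w.u.length + w.v.length
  init := Finset.univ.filter fun q => q.val = 0
  label q := (w.u ++ w.v).getD q.val ∅
  succ q := Finset.univ.filter fun q' => q'.val =
    if q.val + 1 < w.u.length + w.v.length then q.val + 1 else w.u.length
  succ_nonempty q := by
    have hv := List.length_pos_iff.2 w.v_ne_nil
    refine ⟨⟨if q.val + 1 < w.u.length + w.v.length then q.val + 1 else w.u.length, ?_⟩, ?_⟩
    · split_ifs <;> omega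
    · simp

/-- Replace each word by its lasso. -/
def LearnInst.toLassos (I : LearnInst UPWord) : LearnInst Kripke where
  numProp := I.numProp
  numProp_pos := I.numProp_pos
  pos := I.pos.map lasso
  neg := I.neg.map lasso
  bound := I.bound

end LearnTL

/-! In the lasso of a word `w` every state has exactly one successor, so exactly one infinite path
starts from it. There `∃` and `∀` say the same, and so do all coalitions in the game version, where
each agent has a single action. Hence a formula holds in the lasso iff the LTL formula obtained by
erasing its quantifiers holds on `w` (`BForm.sat_iff_sat_erase`, `models_lasso_iff`,
`models_gameLasso_iff`). Erasing quantifiers, or inserting the same one everywhere, maps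
sub-formulas onto sub-formulas and preserves main operators. So neither the size nor the number of
binary sub-formulas grows, and separating formulas transfer in both directions
(`exists_separating_iff`).

The rest is the space bound. A single machine, `lassoMachine mid`, serves both reductions: it copies
the labels and writes after each one the constant word `mid` and the number of the successor. Its
only memory besides the finite control is a binary counter with two tracks. One holds the number of
letters read in the current word. The other follows it through `u` and is frozen during `v`, so that
`|u|`, the target of the last edge, is available at the end. Both numbers are at most the input
length, which gives logarithmic space. The `runs_*` lemmas follow the machine from single steps to a
whole instance (`lassoMachine_computesInSpace`); `enc_lasso` and `enc_gameLasso` identify its output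
with the encodings of the structures. -/

namespace LearnTL

/-! ### Erasing and inserting quantifiers -/

namespace BForm

variable {p : ℕ} {Qt : Type}

/-- The LTL formula obtained by removing all the quantifiers. -/
def erase : BForm p Qt → LTL p
  | atom x => .atom x
  | neg φ => .neg φ.erase
  | tempUn _ t φ => .tempUn t φ.erase
  | tempBin _ t φ ψ => .tempBin t φ.erase ψ.erase
  | logBin b φ ψ => .logBin b φ.erase ψ.erase

theorem inFragment_erase (Ut : Set UnOp) (Bt : Set TempBin) (Bl : Set LogBin) (φ : BForm p Qt) :
    φ.erase.InFragment Ut Bt Bl ↔ φ.InFragment Ut Bt Bl := by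
  induction φ <;> simp_all [erase, InFragment, LTL.InFragment]

theorem isBin_erase (φ : BForm p Qt) : φ.erase.isBin = φ.isBin := by
  cases φ <;> rfl

/-- Sizes are compared through this image. Only `≤` can follow, since sub-formulas differing only in
their quantifiers are merged; `≤` is all that a bound requires. -/
theorem subF_erase [DecidableEq Qt] (φ : BForm p Qt) :
    φ.erase.subF = φ.subF.image erase := by
  induction φ <;> simp_all [erase, subF, LTL.subF, Finset.image_insert, Finset.image_union]

theorem size_erase_le [DecidableEq Qt] (φ : BForm p Qt) : φ.erase.size ≤ φ.size := by
  rw [LTL.size, subF_erase]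
  exact Finset.card_image_le

theorem nbBin_erase_le [DecidableEq Qt] (φ : BForm p Qt) : φ.erase.nbBin ≤ φ.nbBin := by
  rw [LTL.nbBin, subF_erase, Finset.filter_image]
  simp only [isBin_erase]
  exact Finset.card_image_le

/-- In a structure where each quantifier speaks about the only path, that of the iterates of `f`,
a formula says the same as the LTL formula without its quantifiers. -/
theorem sat_iff_sat_erase {Q : Type} (label : Q → Finset (Fin p))
    (quant : Qt → Q → Set (ℕ → Q) → Prop) (f : Q → Q)
    (hf : ∀ A q T, quant A q T ↔ (fun i => f^[i] q) ∈ T) (φ : BForm p Qt) (q : Q) :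
    φ.Sat label quant q ↔ φ.erase.Sat fun i => label (f^[i] q) := by
  -- The `i`-th suffix of the word read from `q` is the word read from the `i`-th iterate, which is
  -- why the induction is over all `q`.
  have shift : ∀ q i, (fun j => label (f^[i + j] q)) = fun j => label (f^[j] (f^[i] q)) := by
    intro q i
    funext j
    rw [Nat.add_comm, Function.iterate_add_apply]
  induction φ generalizing q with
  | atom x => simp [Sat, LTL.Sat, erase]
  | neg φ ih => simp [Sat, LTL.Sat, erase, ih]
  | tempUn A t φ ih =>
    simp only [Sat, LTL.Sat, erase, hf, Set.mem_ofPred_eq, ih, shift]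
  | tempBin A t φ ψ ih₁ ih₂ =>
    simp only [Sat, LTL.Sat, erase, hf, Set.mem_ofPred_eq, ih₁, ih₂, shift]
  | logBin b φ ψ ih₁ ih₂ => simp only [Sat, LTL.Sat, erase, ih₁, ih₂]

end BForm

namespace LTL

variable {p : ℕ} {Qt : Type}

/-- Put the quantifier `A` in front of each temporal operator. -/
def quantify (A : Qt) : LTL p → BForm p Qt
  | atom x => .atom x
  | neg φ => .neg (φ.quantify A)
  | tempUn t φ => .tempUn A t (φ.quantify A)
  | tempBin t φ ψ => .tempBin A t (φ.quantify A) (ψ.quantify A)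
  | logBin b φ ψ => .logBin b (φ.quantify A) (ψ.quantify A)

theorem erase_quantify (A : Qt) (φ : LTL p) : (φ.quantify A).erase = φ := by
  induction φ <;> simp_all [quantify, BForm.erase]

theorem isBin_quantify (A : Qt) (φ : LTL p) : (φ.quantify A).isBin = φ.isBin := by
  cases φ <;> rfl

theorem subF_quantify [DecidableEq Qt] (A : Qt) (φ : LTL p) :
    (φ.quantify A).subF = φ.subF.image (quantify A) := by
  induction φ <;>
    simp_all [quantify, subF, BForm.subF, Finset.image_insert, Finset.image_union]

theorem size_quantify_le [DecidableEq Qt] (A : Qt) (φ : LTL p) :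
    (φ.quantify A).size ≤ φ.size := by
  rw [BForm.size, subF_quantify]
  exact Finset.card_image_le

theorem nbBin_quantify_le [DecidableEq Qt] (A : Qt) (φ : LTL p) :
    (φ.quantify A).nbBin ≤ φ.nbBin := by
  rw [BForm.nbBin, subF_quantify, Finset.filter_image]
  simp only [isBin_quantify]
  exact Finset.card_image_le

end LTL

/-- If `g` turns each word into a model of the same formulas, up to the quantifiers, then
separating words amounts to separating their images. -/
theorem exists_separating_iff {p : ℕ} {Qt Model : Type} [DecidableEq Qt] (A : Qt)
    (sat : Model → BForm p Qt → Prop) (g : UPWord p → Model)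
    (hg : ∀ w φ, sat (g w) φ ↔ φ.erase.Sat w.toSeq)
    (Ut : Set UnOp) (Bt : Set TempBin) (Bl : Set LogBin) (n : ℕ∞) (P N : List (UPWord p)) (B : ℕ) :
    (∃ φ : LTL p, φ.InFragment Ut Bt Bl ∧ φ.size ≤ B ∧ (φ.nbBin : ℕ∞) ≤ n ∧
        Separates (fun w φ => LTL.Sat w.toSeq φ) P N φ) ↔
      ∃ φ : BForm p Qt, φ.InFragment Ut Bt Bl ∧ φ.size ≤ B ∧ (φ.nbBin : ℕ∞) ≤ n ∧
        Separates sat (P.map g) (N.map g) φ := by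
  constructor
  · rintro ⟨φ, h₁, h₂, h₃, h₄, h₅⟩
    refine ⟨φ.quantify A, ?_, (φ.size_quantify_le A).trans h₂,
      le_trans (by exact_mod_cast φ.nbBin_quantify_le A) h₃, ?_, ?_⟩
    · rwa [← BForm.inFragment_erase, LTL.erase_quantify]
    · simpa [hg, LTL.erase_quantify] using h₄
    · simpa [hg, LTL.erase_quantify] using h₅
  · rintro ⟨φ, h₁, h₂, h₃, h₄, h₅⟩
    refine ⟨φ.erase, (BForm.inFragment_erase ..).2 h₁, φ.size_erase_le.trans h₂,
      le_trans (by exact_mod_cast φ.nbBin_erase_le) h₃, ?_, ?_⟩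
    · simpa [hg] using h₄
    · simpa [hg] using h₅

/-! ### Lassos -/

namespace UPWord

variable {p : ℕ}

theorem length_v_pos (w : UPWord p) : 0 < w.v.length := List.length_pos_iff.2 w.v_ne_nil

/-- The position after `i` in the lasso of `w`. -/
def nextPos (w : UPWord p) (i : ℕ) : ℕ :=
  if i + 1 < w.u.length + w.v.length then i + 1 else w.u.length

theorem nextPos_lt (w : UPWord p) (i : ℕ) : w.nextPos i < w.u.length + w.v.length := by
  have := w.length_v_pos
  unfold nextPos
  split_ifs <;> omega

/-- `nextPos` as a map on the states of the lasso. -/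
def nextState (w : UPWord p) (q : Fin (lasso w).numStates) : Fin (lasso w).numStates :=
  ⟨w.nextPos q, w.nextPos_lt q⟩

/-- The first state of the lasso. -/
def firstState (w : UPWord p) : Fin (lasso w).numStates :=
  ⟨0, Nat.add_pos_right _ w.length_v_pos⟩

theorem val_iterate_nextState (w : UPWord p) (i : ℕ) :
    (w.nextState^[i] w.firstState).val =
      if i < w.u.length then i else w.u.length + (i - w.u.length) % w.v.length := by
  have hv := w.length_v_pos
  induction i with
  | zero =>
    simp only [Function.iterate_zero, id_eq, firstState]
    split_ifs
    · rfl
    · simp; omega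
  | succ i ih =>
    rw [Function.iterate_succ_apply']
    simp only [nextState, nextPos, ih]
    -- Three cases for the new position: still in `u`, at the first letter of `v`, or further along
    -- the loop.
    rcases lt_trichotomy (i + 1) w.u.length with h | h | h
    · rw [if_pos (by omega : i < w.u.length), if_pos h, if_pos (by omega)]
    · rw [if_pos (by omega : i < w.u.length), if_neg (by omega : ¬ i + 1 < w.u.length),
        if_pos (by omega)]
      simp [h]
    · rw [if_neg (by omega : ¬ i < w.u.length), if_neg (by omega : ¬ i + 1 < w.u.length),
        show i + 1 - w.u.length = (i - w.u.length) + 1 by omega, Nat.add_mod_eq_ite]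
      have := Nat.mod_lt (i - w.u.length) hv
      -- A loop of length 1 is apart because `1 % 1 = 0`, while `1 % |v| = 1` otherwise.
      rcases Nat.eq_or_lt_of_le hv with h1 | h1
      · simp only [← h1, Nat.mod_one]; simp
      · have h2 : 1 % w.v.length = 1 := Nat.mod_eq_of_lt h1
        rw [h2]
        split_ifs <;> omega

theorem label_iterate_nextState (w : UPWord p) (i : ℕ) :
    (w.u ++ w.v).getD (w.nextState^[i] w.firstState).val ∅ = w.toSeq i := by
  rw [val_iterate_nextState, toSeq]
  split_ifs with h
  · rw [List.getD_append _ _ _ _ h]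
  · rw [List.getD_append_right _ _ _ _ (by omega)]
    congr 1
    omega

end UPWord

/-- A sequence which follows `f` consists of the iterates of `f`. -/
theorem eq_iterate_of_succ {Q : Type} {f : Q → Q} {ρ : ℕ → Q} {q : Q} (h₀ : ρ 0 = q)
    (h : ∀ i, ρ (i + 1) = f (ρ i)) : ρ = fun i => f^[i] q := by
  funext i
  induction i with
  | zero => exact h₀
  | succ i ih => rw [h, ih, Function.iterate_succ_apply']

theorem out_lasso {p : ℕ} (w : UPWord p) (q : Fin (lasso w).numStates) :
    (lasso w).Out q = {fun i => w.nextState^[i] q} := by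
  have hs : ∀ q q' : Fin (lasso w).numStates,
      q' ∈ (lasso w).succ q ↔ q' = w.nextState q := by
    intro q q'
    rw [Fin.ext_iff]
    exact Finset.mem_filter_univ q'
  ext ρ
  simp only [Kripke.Out, hs, Set.mem_ofPred_eq, Set.mem_singleton_iff]
  constructor
  · rintro ⟨h₀, h⟩
    exact eq_iterate_of_succ h₀ h
  · rintro rfl
    exact ⟨rfl, fun i => Function.iterate_succ_apply' ..⟩

/-- The initial state is unique, so rejecting a formula means falsifying it there, and the path from
each state is unique, so both path quantifiers evaluate on it. -/
theorem models_lasso_iff {p : ℕ} (w : UPWord p) (φ : CTL p) :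
    (lasso w).Models φ ↔ φ.erase.Sat w.toSeq := by
  have hinit : ∀ q, q ∈ (lasso w).init ↔ q = w.firstState := by
    intro q
    rw [Fin.ext_iff]
    exact Finset.mem_filter_univ q
  have hq : ∀ A q T, (lasso w).Quant A q T ↔ (fun i => w.nextState^[i] q) ∈ T := by
    intro A q T
    cases A <;> simp [Kripke.Quant, out_lasso]
  simp only [Kripke.Models, hinit, forall_eq]
  rw [BForm.sat_iff_sat_erase _ _ w.nextState hq]
  have : (fun i => (lasso w).label (w.nextState^[i] w.firstState)) = w.toSeq :=
    funext w.label_iterate_nextState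
  rw [this]

/-- The lasso of a word as a concurrent game structure where each agent always has one action. -/
abbrev gameLasso (k : ℕ) {p : ℕ} (w : UPWord p) : CGS k p where
  numStates := (lasso w).numStates
  init := (lasso w).init
  label := (lasso w).label
  d _ _ := 1
  d_pos _ _ := Nat.one_pos
  δ q _ := w.nextState q

theorem out_gameLasso {k p : ℕ} (w : UPWord p) (A : Finset (Fin k))
    (q : Fin (gameLasso k w).numStates) (s : (gameLasso k w).Profile A) :
    (gameLasso k w).Out q s = {fun i => w.nextState^[i] q} := by
  have hs : ∀ q α, (gameLasso k w).Succ A q α = {w.nextState q} := by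
    intro q α
    ext q'
    simp only [CGS.Succ, Set.mem_ofPred_eq, Set.mem_singleton_iff]
    constructor
    · rintro ⟨β, -, rfl⟩
      rfl
    · rintro rfl
      exact ⟨fun _ => (0 : Fin 1), fun a h => Subsingleton.elim (α := Fin 1) _ _, rfl⟩
  ext ρ
  simp only [CGS.Out, hs, Set.mem_ofPred_eq, Set.mem_singleton_iff]
  constructor
  · rintro ⟨h₀, h⟩
    exact eq_iterate_of_succ h₀ h
  · rintro rfl
    exact ⟨rfl, fun i => Function.iterate_succ_apply' ..⟩

theorem models_gameLasso_iff {k p : ℕ} (w : UPWord p) (φ : ATL k p) :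
    (gameLasso k w).Models φ ↔ φ.erase.Sat w.toSeq := by
  have hinit : ∀ q, q ∈ (gameLasso k w).init ↔ q = w.firstState := by
    intro q
    rw [Fin.ext_iff]
    exact Finset.mem_filter_univ q
  have hq : ∀ A q T, (gameLasso k w).Quant A q T ↔ (fun i => w.nextState^[i] q) ∈ T := by
    intro A q T
    simp only [CGS.Quant, out_gameLasso, Set.mem_singleton_iff, forall_eq]
    -- The outcome does not depend on the strategies, so it is enough that some profile exists.
    exact ⟨fun ⟨_, h⟩ => h, fun h => ⟨fun _ _ _ _ => (0 : Fin 1), h⟩⟩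
  simp only [CGS.Models, hinit, forall_eq]
  rw [BForm.sat_iff_sat_erase _ _ w.nextState hq]
  have : (fun i => (gameLasso k w).label (w.nextState^[i] w.firstState)) = w.toSeq :=
    funext w.label_iterate_nextState
  rw [this]

/-- Replace each word by the game structure of its lasso. -/
def LearnInst.toGameLassos (k : ℕ) (I : LearnInst UPWord) : LearnInst (CGS k) where
  numProp := I.numProp
  numProp_pos := I.numProp_pos
  pos := I.pos.map (gameLasso k)
  neg := I.neg.map (gameLasso k)
  bound := I.bound

/-! ### Computations in bounded space -/

namespace Transducer

/-- `M` goes from `c` to `c'`, and before each step its heads are in the first `s` cells. -/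
def RunsInSpace (M : Transducer) (x : List Bool) (s : ℕ) : M.Config → M.Config → Prop :=
  Relation.ReflTransGen fun c c' => M.next x c = some c' ∧ ∀ t, c.head t < s

theorem RunsInSpace.reaches {M : Transducer} {x : List Bool} {s : ℕ} {c c' : M.Config}
    (h : M.RunsInSpace x s c c') : M.Reaches x c c' :=
  Relation.ReflTransGen.mono (fun _ _ h => h.1) _ _ h

theorem RunsInSpace.trans {M : Transducer} {x : List Bool} {s : ℕ} {c c' c'' : M.Config}
    (h : M.RunsInSpace x s c c') (h' : M.RunsInSpace x s c' c'') : M.RunsInSpace x s c c'' :=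
  Relation.ReflTransGen.trans h h'

/-- As the machine is deterministic, a halting computation in bounded space bounds the heads in
all the reachable configurations. -/
theorem RunsInSpace.head_lt {M : Transducer} {x : List Bool} {s : ℕ} {c c' c'' : M.Config}
    (h : M.RunsInSpace x s c c') (hhalt : M.next x c' = none) (hs : ∀ t, c'.head t < s)
    (h' : M.Reaches x c c'') : ∀ t, c''.head t < s := by
  induction h using Relation.ReflTransGen.head_induction_on with
  | refl =>
    rcases Relation.ReflTransGen.cases_head h' with rfl | ⟨d, hd, -⟩
    · exact hs
    · rw [hhalt] at hd
      cases hd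
  | head hstep _ ih =>
    rcases Relation.ReflTransGen.cases_head h' with rfl | ⟨d, hd, hr⟩
    · exact hstep.2
    · rw [hstep.1] at hd
      cases hd
      exact ih hr

theorem RunsInSpace.computesInSpace {M : Transducer} {x : List Bool} {s : ℕ} {c : M.Config}
    (h : M.RunsInSpace x s M.initial c) (hhalt : M.next x c = none) (hs : ∀ t, c.head t < s) :
    M.ComputesInSpace x c.out s :=
  ⟨⟨c, h.reaches, hhalt, rfl⟩, fun _ h' => h.head_lt hhalt hs h'⟩

end Transducer

/-! ### Binary increment -/

/-- Add the carry `b` to a number given by its binary digits. -/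
def addCarry : Bool → List Bool → List Bool
  | false, [] => []
  | true, [] => [true]
  | b, c :: l => (c ^^ b) :: addCarry (c && b) l

theorem addCarry_false (l : List Bool) : addCarry false l = l := by
  induction l <;> simp_all [addCarry]

theorem addCarry_true_bits (n : ℕ) : addCarry true n.bits = (n + 1).bits := by
  induction n using Nat.binaryRec' with
  | zero => simp [addCarry]
  | bit b n hn ih =>
    rw [Nat.bits_append_bit n b hn, addCarry]
    cases b
    · simp [addCarry_false, Nat.bit]
    -- For an odd number the low digit becomes 0 and the carry moves on to `n`.
    · have : Nat.bit true n + 1 = 2 * (n + 1) := by simp [Nat.bit]; ring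
      rw [this, Nat.bit0_bits _ (by omega)]
      simp [ih]

theorem length_bits_le_log (n m : ℕ) (h : n ≤ m) : n.bits.length ≤ Nat.log 2 m + 1 := by
  rw [Nat.size_eq_bits_len, Nat.size_le]
  exact h.trans_lt (Nat.lt_pow_succ_log_self one_lt_two m)

/-! ### The machine -/

/-- Symbols on the work tape. A digit cell holds a digit of the number of letters read so far, and
possibly a digit of the number of letters of the first part of the word. -/
inductive Cell
  | blank
  | marker
  | digit (c : Bool) (d : Option Bool)
  deriving Fintype

/-- States of the machine. The argument `s` tells whether the second list of words is being
read, and `v` whether the second part of a word is being read. -/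
inductive LassoState
  | start
  | unary
  | list (s : Bool)
  | word (s v first : Bool)
  | label (s v : Bool)
  | labelBit (s v : Bool)
  | peek (s : Bool)
  | inc (s v carry : Bool)
  | back (s v : Bool)
  | flush (s : Bool)
  | clear (s : Bool)
  | copy
  deriving Fintype

/-- The cell obtained by adding `carry` to a cell; in the first part of a word, the second
digit follows the first one. -/
def incCell (v carry : Bool) (x : Bool × Option Bool) : Bool × Option Bool :=
  (x.1 ^^ carry, if v then x.2 else some (x.1 ^^ carry))

/-- The new cell at the end of the counter. -/
def newCell (v : Bool) : Bool × Option Bool := (true, if v then none else some true)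

/-- The code of an optional digit. -/
def encDigit (d : Option Bool) : List Bool := d.elim [] fun b => [true, b]

/-- The transition function. The word `mid` is written after each label. -/
def lassoStep (mid : List Bool) :
    LassoState → InSym → Cell → Option (LassoState × Dir × (Cell × Dir) × List Bool)
  | .start, _, _ => some (.unary, .right, (.marker, .right), [])
  | .unary, .bit b, w => some (if b then .unary else .list false, .right, (w, .stay), [b])
  | .list s, .bit true, w => some (.word s false true, .right, (w, .stay), [true])
  | .list s, .bit false, w =>
      some (if s then .copy else .list true, .right, (w, .stay), [false])
  | .word s v f, .bit true, w => some (.label s v, .right, (w, .stay), [true, f])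
  -- End of `u`: nothing is written, as the rows of `u` and `v` form one list. The flag `f`
  -- survives, so the initial state is right even when `u` is empty.
  | .word s _ f, .bit false, w => some (.word s true f, .right, (w, .stay), [])
  | .label s v, .bit true, w => some (.labelBit s v, .right, (w, .stay), [true])
  -- The written `false` closes the label and the final `true` opens the one-element list of
  -- successors.
  | .label s v, .bit false, w =>
      some (if v then .peek s else .inc s false true, .right, (w, .stay),
        false :: (mid ++ [true]))
  | .labelBit s v, .bit b, w => some (.label s v, .right, (w, .stay), [b])
  -- The successor of a letter of `v` depends on whether another letter follows; a following letter
  -- is left unread.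
  | .peek s, .bit true, w => some (.inc s true true, .stay, (w, .stay), [])
  | .peek s, .bit false, w => some (.flush s, .right, (w, .stay), [])
  | .inc s v b, _, .digit c d =>
      some (.inc s v (c && b), .stay,
        (.digit (incCell v b (c, d)).1 (incCell v b (c, d)).2, .right), [true, c ^^ b])
  | .inc s v true, _, .blank =>
      some (.inc s v false, .stay, (.digit (newCell v).1 (newCell v).2, .right), [true, true])
  | .inc s v false, _, .blank => some (.back s v, .stay, (.blank, .left), [false, false])
  | .back s v, _, .digit c d => some (.back s v, .stay, (.digit c d, .left), [])
  | .back s v, _, .marker => some (.word s v false, .stay, (.marker, .right), [])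
  | .flush s, _, .digit c d => some (.flush s, .stay, (.digit c d, .right), encDigit d)
  -- The three terminators close the digits, the list of successors and the table.
  | .flush s, _, .blank => some (.clear s, .stay, (.blank, .left), [false, false, false])
  | .clear s, _, .digit _ _ => some (.clear s, .stay, (.blank, .left), [])
  | .clear s, _, .marker => some (.list s, .stay, (.marker, .right), [])
  | .copy, .bit b, w => some (.copy, .right, (w, .stay), [b])
  | _, _, _ => none

/-- The machine that replaces the words of a learning instance by their lassos. -/
def lassoMachine (mid : List Bool) : Transducer where
  State := LassoState
  Work := Cell
  finState := inferInstance
  finWork := inferInstance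
  blank := .blank
  tapes := 1
  start := .start
  step q a w := (lassoStep mid q a (w 0)).map fun r => (r.1, r.2.1, fun _ => r.2.2.1, r.2.2.2)

/-- The tape that holds the counter `l` after the left marker. -/
def counterTape (l : List (Bool × Option Bool)) : ℕ → Cell
  | 0 => .marker
  | i + 1 => match l[i]? with
    | some x => .digit x.1 x.2
    | none => .blank

theorem counterTape_length_append (l : List (Bool × Option Bool)) (x : Bool × Option Bool)
    (m : List (Bool × Option Bool)) :
    counterTape (l ++ x :: m) (l.length + 1) = .digit x.1 x.2 := by
  have : (l ++ x :: m)[l.length]? = some x := by simp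
  simp only [counterTape, this]

theorem counterTape_length (l : List (Bool × Option Bool)) :
    counterTape l (l.length + 1) = .blank := by
  simp [counterTape]

/-- With `m.tail`, one statement covers overwriting a digit and, when `m` is empty, appending a new
one. -/
theorem update_counterTape (l : List (Bool × Option Bool)) (x : Bool × Option Bool)
    (m : List (Bool × Option Bool)) :
    Function.update (counterTape (l ++ m)) (l.length + 1) (.digit x.1 x.2) =
      counterTape (l ++ x :: m.tail) := by
  funext i
  rcases eq_or_ne i (l.length + 1) with rfl | h
  · rw [Function.update_self, counterTape_length_append]
  · rw [Function.update_of_ne h]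
    cases i with
    | zero => rfl
    | succ i =>
      have h : i ≠ l.length := fun e => h (by rw [e])
      simp only [counterTape]
      congr 1
      rcases lt_or_gt_of_ne h with h | h
      · rw [List.getElem?_append_left h, List.getElem?_append_left h]
      · rw [List.getElem?_append_right h.le, List.getElem?_append_right h.le]
        obtain ⟨j, hj⟩ : ∃ j, i - l.length = j + 1 := ⟨i - l.length - 1, by omega⟩
        simp [hj]

theorem update_counterTape_blank (l : List (Bool × Option Bool)) (x : Bool × Option Bool) :
    Function.update (counterTape (l ++ [x])) (l.length + 1) .blank = counterTape l := by
  funext i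
  rcases eq_or_ne i (l.length + 1) with rfl | h
  · rw [Function.update_self, counterTape_length]
  · rw [Function.update_of_ne h]
    cases i with
    | zero => rfl
    | succ i =>
      have h : i ≠ l.length := fun e => h (by rw [e])
      simp only [counterTape]
      congr 1
      rcases lt_or_gt_of_ne h with h | h
      · rw [List.getElem?_append_left h]
      · rw [List.getElem?_eq_none (by simp; omega), List.getElem?_eq_none h.le]

/-- The configuration in state `q` when the part `r` of the input is still to be read, the head
of the work tape is at `h`, the counter is `l`, and `o` has been written. -/
def lassoConfig (mid x : List Bool) (q : LassoState) (r : List Bool) (h : ℕ)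
    (l : List (Bool × Option Bool)) (o : List Bool) : (lassoMachine mid).Config where
  state := q
  inHead := x.length + 1 - r.length
  head := fun _ => h
  tape := fun _ => counterTape l
  out := o

/-- Cell 0 is the left end marker, hence the `+ 1`; the empty suffix corresponds to the right end
marker. -/
theorem inputAt_suffix {x r : List Bool} (h : r <:+ x) :
    inputAt x (x.length + 1 - r.length) = match r.head? with
      | some b => .bit b
      | none => .rightEnd := by
  obtain ⟨y, rfl⟩ := h
  have : (y ++ r).length + 1 - r.length = y.length + 1 := by simp; omega
  rw [this]
  cases r <;> simp [inputAt]

/-! ### Runs of the machine: single steps, label copying, and passes over the counter -/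

section Runs

variable {mid x : List Bool} {s : ℕ}

/-- A step which reads a bit of the input and leaves the work tape unchanged. -/
theorem runs_read {q q' : LassoState} {b : Bool} {r : List Bool} {h : ℕ}
    {l : List (Bool × Option Bool)} {o o' : List Bool} (hx : b :: r <:+ x) (hs : h < s)
    (hstep : lassoStep mid q (.bit b) (counterTape l h) =
      some (q', .right, (counterTape l h, .stay), o')) :
    (lassoMachine mid).RunsInSpace x s (lassoConfig mid x q (b :: r) h l o)
      (lassoConfig mid x q' r h l (o ++ o')) := by
  refine Relation.ReflTransGen.single ⟨?_, fun _ => hs⟩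
  have hi := inputAt_suffix hx
  have hlen := hx.length_le
  simp only [List.length_cons] at hlen hi
  simp only [List.head?_cons] at hi
  simp only [Transducer.next, lassoConfig, lassoMachine, List.length_cons, hi, hstep,
    Option.map_some, Dir.move, Function.update_eq_self]
  congr 2
  omega

/-- A step which does not move the head of the input. -/
theorem runs_stay {q q' : LassoState} {r : List Bool} {h h' : ℕ}
    {l l' : List (Bool × Option Bool)} {o o' : List Bool} {w : Cell} {d : Dir} (hs : h < s)
    (hstep : lassoStep mid q (inputAt x (x.length + 1 - r.length)) (counterTape l h) =
      some (q', .stay, (w, d), o'))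
    (hh : d.move h = h') (hl : Function.update (counterTape l) h w = counterTape l') :
    (lassoMachine mid).RunsInSpace x s (lassoConfig mid x q r h l o)
      (lassoConfig mid x q' r h' l' (o ++ o')) := by
  refine Relation.ReflTransGen.single ⟨?_, fun _ => hs⟩
  simp only [Transducer.next, lassoConfig, lassoMachine, hstep,
    Option.map_some, show ∀ i, Dir.stay.move i = i from fun _ => rfl, hh, hl]
  congr 2
  omega

theorem runs_unary (n : ℕ) {r : List Bool} {h : ℕ} {l : List (Bool × Option Bool)}
    {o : List Bool} (hx : encUnary n ++ r <:+ x) (hs : h < s) :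
    (lassoMachine mid).RunsInSpace x s (lassoConfig mid x .unary (encUnary n ++ r) h l o)
      (lassoConfig mid x (.list false) r h l (o ++ encUnary n)) := by
  induction n generalizing o with
  | zero => exact runs_read hx hs rfl
  | succ n ih =>
    have e : encUnary (n + 1) = true :: encUnary n := rfl
    rw [e, List.cons_append] at hx ⊢
    refine (runs_read hx hs rfl).trans ?_
    have := ih (o := o ++ [true]) ((List.suffix_cons _ _).trans hx)
    simpa using this

theorem runs_label (bs : List Bool) {t v : Bool} {r : List Bool} {h : ℕ}
    {l : List (Bool × Option Bool)} {o : List Bool} (hx : encList encBool bs ++ r <:+ x)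
    (hs : h < s) :
    (lassoMachine mid).RunsInSpace x s
      (lassoConfig mid x (.label t v) (encList encBool bs ++ r) h l o)
      (lassoConfig mid x (if v then .peek t else .inc t false true) r h l
        (o ++ (encList encBool bs ++ (mid ++ [true])))) := by
  induction bs generalizing o with
  | nil => exact runs_read hx hs rfl
  | cons b bs ih =>
    have e : encList encBool (b :: bs) = true :: b :: encList encBool bs := rfl
    rw [e, List.cons_append, List.cons_append] at hx ⊢
    have hx' := (List.suffix_cons _ _).trans hx
    refine (runs_read hx hs rfl).trans ((runs_read hx' hs rfl).trans ?_)
    have := ih (o := o ++ [true] ++ [b]) ((List.suffix_cons _ _).trans hx')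
    simpa using this

/-- The counter after adding a carry. -/
def incCounter (v : Bool) : Bool → List (Bool × Option Bool) → List (Bool × Option Bool)
  | false, [] => []
  | true, [] => [newCell v]
  | b, a :: l => incCell v b a :: incCounter v (a.1 && b) l

theorem map_fst_incCounter (v b : Bool) (l : List (Bool × Option Bool)) :
    (incCounter v b l).map Prod.fst = addCarry b (l.map Prod.fst) := by
  induction l generalizing b with
  | nil => cases b <;> simp [incCounter, addCarry, newCell]
  | cons a l ih => simp [incCounter, addCarry, incCell, ih]

theorem filterMap_snd_incCounter_false (b : Bool) (l : List (Bool × Option Bool)) :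
    (incCounter false b l).filterMap Prod.snd = addCarry b (l.map Prod.fst) := by
  induction l generalizing b with
  | nil => cases b <;> simp [incCounter, addCarry, newCell]
  | cons a l ih => simp [incCounter, addCarry, incCell, ih]

theorem filterMap_snd_incCounter_true (b : Bool) (l : List (Bool × Option Bool)) :
    (incCounter true b l).filterMap Prod.snd = l.filterMap Prod.snd := by
  induction l generalizing b with
  | nil => cases b <;> simp [incCounter, newCell]
  | cons a l ih => simp [incCounter, incCell, List.filterMap_cons, ih]

/-- One pass both increments the counter and writes it: the successor of position `n` is `n + 1`,
and digits come least significant first on the tape and in the code. Here `l` is already processed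
and `m` is not; the extra `false` closes the list of successors. -/
theorem runs_inc (l m : List (Bool × Option Bool)) {b t v : Bool} {r o : List Bool}
    (hs : (l ++ incCounter v b m).length + 1 < s) :
    (lassoMachine mid).RunsInSpace x s
      (lassoConfig mid x (.inc t v b) r (l.length + 1) (l ++ m) o)
      (lassoConfig mid x (.back t v) r (l ++ incCounter v b m).length (l ++ incCounter v b m)
        (o ++ (encList encBool (addCarry b (m.map Prod.fst)) ++ [false]))) := by
  have last : ∀ (l : List (Bool × Option Bool)) (o : List Bool), l.length + 1 < s →
      (lassoMachine mid).RunsInSpace x s (lassoConfig mid x (.inc t v false) r (l.length + 1) l o)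
        (lassoConfig mid x (.back t v) r l.length l (o ++ [false, false])) := by
    intro l o hs
    refine runs_stay (w := .blank) (d := .left) hs ?_ rfl ?_
    · rw [counterTape_length]; rfl
    · rw [← counterTape_length l, Function.update_eq_self]
  induction m generalizing l b o with
  | nil =>
    cases b with
    | false => simpa [incCounter, addCarry, encList] using last l o (by simpa [incCounter] using hs)
    | true =>
      simp only [incCounter, List.length_append, List.length_singleton] at hs
      have h₁ : (lassoMachine mid).RunsInSpace x s
          (lassoConfig mid x (.inc t v true) r (l.length + 1) l o)
          (lassoConfig mid x (.inc t v false) r ((l ++ [newCell v]).length + 1) (l ++ [newCell v])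
            (o ++ [true, true])) := by
        refine runs_stay (w := .digit (newCell v).1 (newCell v).2) (d := .right) (by omega) ?_
          (by simp [Dir.move]) ?_
        · rw [counterTape_length]; rfl
        · simpa using update_counterTape l (newCell v) []
      have h₂ := h₁.trans (last _ _ (by simpa using hs))
      simpa [incCounter, addCarry, encList, encBool] using h₂
  | cons a m ih =>
    have e : l ++ incCounter v b (a :: m) = (l ++ [incCell v b a]) ++ incCounter v (a.1 && b) m := by
      simp [incCounter]
    rw [e] at hs ⊢
    have h₁ : (lassoMachine mid).RunsInSpace x s
        (lassoConfig mid x (.inc t v b) r (l.length + 1) (l ++ a :: m) o)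
        (lassoConfig mid x (.inc t v (a.1 && b)) r ((l ++ [incCell v b a]).length + 1)
          ((l ++ [incCell v b a]) ++ m) (o ++ [true, a.1 ^^ b])) := by
      refine runs_stay (w := .digit (incCell v b a).1 (incCell v b a).2) (d := .right) ?_ ?_
          (by simp [Dir.move]) ?_
      · simp only [List.length_append] at hs; omega
      · rw [counterTape_length_append]; rfl
      · simpa using update_counterTape l (incCell v b a) (a :: m)
    have h₂ := h₁.trans (ih _ hs)
    simpa [addCarry, encList, encBool] using h₂

/-- The head moves left, so the induction removes digits from the right end of `l`. -/
theorem runs_back (l m : List (Bool × Option Bool)) {t v : Bool} {r o : List Bool}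
    (hs : l.length < s) :
    (lassoMachine mid).RunsInSpace x s (lassoConfig mid x (.back t v) r l.length (l ++ m) o)
      (lassoConfig mid x (.word t v false) r 1 (l ++ m) o) := by
  induction l using List.reverseRecOn generalizing m with
  | nil =>
    have : (lassoMachine mid).RunsInSpace x s (lassoConfig mid x (.back t v) r 0 m o)
        (lassoConfig mid x (.word t v false) r 1 m (o ++ [])) :=
      runs_stay (w := .marker) (d := .right) hs rfl rfl (Function.update_eq_self 0 (counterTape m))
    simpa using this
  | append_singleton l a ih =>
    simp only [List.length_append, List.length_singleton] at hs
    have h₁ : (lassoMachine mid).RunsInSpace x s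
        (lassoConfig mid x (.back t v) r (l.length + 1) (l ++ a :: m) o)
        (lassoConfig mid x (.back t v) r l.length (l ++ a :: m) (o ++ [])) := by
      refine runs_stay (w := .digit a.1 a.2) (d := .left) hs ?_ rfl ?_
      · rw [counterTape_length_append]; rfl
      · rw [update_counterTape]; rfl
    have h₂ := h₁.trans (by simpa using ih (a :: m) (by omega))
    simpa using h₂

/-- Cells created while reading `v` carry no second digit and write nothing, hence the `filterMap`.
-/
theorem runs_flush (l m : List (Bool × Option Bool)) {t : Bool} {r o : List Bool}
    (hs : (l ++ m).length + 1 < s) :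
    (lassoMachine mid).RunsInSpace x s (lassoConfig mid x (.flush t) r (l.length + 1) (l ++ m) o)
      (lassoConfig mid x (.clear t) r (l ++ m).length (l ++ m)
        (o ++ (encList encBool (m.filterMap Prod.snd) ++ [false, false]))) := by
  induction m generalizing l o with
  | nil =>
    simp only [List.append_nil] at hs ⊢
    refine runs_stay (w := .blank) (d := .left) hs ?_ rfl ?_
    · rw [counterTape_length]; rfl
    · rw [← counterTape_length l, Function.update_eq_self]
  | cons a m ih =>
    have e : l ++ a :: m = (l ++ [a]) ++ m := by simp
    have h₁ : (lassoMachine mid).RunsInSpace x s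
        (lassoConfig mid x (.flush t) r (l.length + 1) (l ++ a :: m) o)
        (lassoConfig mid x (.flush t) r ((l ++ [a]).length + 1) (l ++ a :: m)
          (o ++ encDigit a.2)) := by
      refine runs_stay (w := .digit a.1 a.2) (d := .right) ?_ ?_ (by simp [Dir.move]) ?_
      · simp only [List.length_append] at hs; omega
      · rw [counterTape_length_append]; rfl
      · rw [update_counterTape]; rfl
    rw [e] at hs h₁ ⊢
    have h₂ := h₁.trans (ih _ hs)
    rcases a with ⟨c, _ | d⟩ <;> simpa [encDigit, encList, encBool] using h₂

theorem runs_clear (l : List (Bool × Option Bool)) {t : Bool} {r o : List Bool}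
    (hs : l.length < s) :
    (lassoMachine mid).RunsInSpace x s (lassoConfig mid x (.clear t) r l.length l o)
      (lassoConfig mid x (.list t) r 1 [] o) := by
  induction l using List.reverseRecOn with
  | nil =>
    have : (lassoMachine mid).RunsInSpace x s (lassoConfig mid x (.clear t) r 0 [] o)
        (lassoConfig mid x (.list t) r 1 [] (o ++ [])) :=
      runs_stay (w := .marker) (d := .right) hs rfl rfl (Function.update_eq_self 0 (counterTape []))
    simpa using this
  | append_singleton l a ih =>
    simp only [List.length_append, List.length_singleton] at hs
    have h₁ : (lassoMachine mid).RunsInSpace x s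
        (lassoConfig mid x (.clear t) r (l.length + 1) (l ++ [a]) o)
        (lassoConfig mid x (.clear t) r l.length l (o ++ [])) := by
      refine runs_stay (w := .blank) (d := .left) hs ?_ rfl (update_counterTape_blank l a)
      rw [counterTape_length_append]; rfl
    have h₂ := h₁.trans (by simpa using ih (by omega))
    simpa using h₂

end Runs

/-! ### Encodings of lassos as lists of encoded rows -/

theorem encList_append {α : Type} (e : α → List Bool) (l m : List α) :
    encList e (l ++ m) = (l.flatMap fun a => true :: e a) ++ encList e m := by
  induction l with
  | nil => rfl
  | cons a l ih => simp [encList, ih]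

theorem encList_map {α β : Type} (e : β → List Bool) (g : α → β) (l : List α) :
    encList e (l.map g) = encList (fun a => e (g a)) l := by
  induction l with
  | nil => rfl
  | cons a l ih => simp [encList, ih]

theorem encList_eq_encList_id {α : Type} (e : α → List Bool) (l : List α) :
    encList e l = encList id (l.map e) :=
  (encList_map id e l).symm

/-- The row of a state with label `a` and successor `m`. -/
def lassoRow (mid : List Bool) {p : ℕ} (first : Bool) (a : Finset (Fin p)) (m : ℕ) : List Bool :=
  encBool first ++ (encLabel a ++ (mid ++ encList encBinary [m]))

/-- The rows of the states of the lasso of `w`. -/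
def lassoRows (mid : List Bool) {p : ℕ} (w : UPWord p) : List (List Bool) :=
  (w.u.mapIdx fun i a => lassoRow mid (i == 0) a (i + 1)) ++
    w.v.mapIdx fun i a => lassoRow mid (i + w.u.length == 0) a
      (if i + 1 < w.v.length then i + w.u.length + 1 else w.u.length)

/-- This passes from numbering states globally to the machine's order of work, with `u` and `v`
indexed separately and the indices in `v` shifted by `|u|`. -/
theorem ofFn_lassoRow (mid : List Bool) {p : ℕ} (w : UPWord p) :
    (List.ofFn fun q : Fin (lasso w).numStates =>
      lassoRow mid (decide (q ∈ (lasso w).init)) ((lasso w).label q) (w.nextState q).val) =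
      lassoRows mid w := by
  have hinit : ∀ q, decide (q ∈ (lasso w).init) = (q.val == 0) := by
    intro q
    rw [Bool.eq_iff_iff, decide_eq_true_iff, beq_iff_eq]
    exact Finset.mem_filter_univ q
  have hlen : (lasso w).numStates = w.u.length + w.v.length := rfl
  refine List.ext_getElem (by simp [lassoRows, hlen]) fun i h₁ h₂ => ?_
  simp only [List.getElem_ofFn, hinit]
  rw [List.length_ofFn, hlen] at h₁
  have hlabel : ∀ h, (lasso w).label ⟨i, h⟩ = (w.u ++ w.v).getD i ∅ := fun _ => rfl
  simp only [hlabel, UPWord.nextState, UPWord.nextPos, lassoRows]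
  rcases lt_or_ge i w.u.length with h | h
  · have hv := w.length_v_pos
    rw [List.getElem_append_left (by simpa using h), List.getD_append _ _ _ _ h,
      if_pos (by omega)]
    simp [h]
  · rw [List.getElem_append_right (by simpa using h), List.getD_append_right _ _ _ _ h]
    have h' : i - w.u.length < w.v.length := by omega
    have h'' : i - w.u.length + w.u.length = i := by omega
    have h3 : i - w.u.length + 1 < w.v.length ↔ i + 1 < w.u.length + w.v.length := by omega
    simp [h', h'', h3]

theorem enc_lasso {p : ℕ} (w : UPWord p) : (lasso w).enc = encList id (lassoRows [] w) := by
  rw [← ofFn_lassoRow, Kripke.enc, Kripke.table]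
  have hs : ∀ q, ((List.finRange (lasso w).numStates).filter fun q' => q' ∈ (lasso w).succ q) =
      [w.nextState q] := by
    intro q
    have : ∀ q', decide (q' ∈ (lasso w).succ q) = (q' == w.nextState q) := by
      intro q'
      rw [Bool.eq_iff_iff, decide_eq_true_iff, beq_iff_eq, Fin.ext_iff]
      exact Finset.mem_filter_univ q'
    simp only [this, List.filter_beq]
    rw [List.count_eq_one_of_mem (List.nodup_finRange _) (List.mem_finRange _)]
    rfl
  simp only [hs]
  rw [encList_eq_encList_id, List.map_ofFn]
  rfl

/-- A row differs from a Kripke row only by the list of action counts, which is constant for fixed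
`k` and can be hard-wired as `mid`. -/
theorem enc_gameLasso (k : ℕ) {p : ℕ} (w : UPWord p) :
    (gameLasso k w).enc =
      encList id (lassoRows (encList encUnary (List.replicate k 1)) w) := by
  rw [← ofFn_lassoRow, CGS.enc, CGS.table]
  have hd : (List.ofFn fun _ : Fin k => 1) = List.replicate k 1 := List.ofFn_const k 1
  have hδ : ∀ q, (List.ofFn fun j : Fin (∏ a, (gameLasso k w).d q a) =>
      ((gameLasso k w).δ q (finPiFinEquiv.symm j)).val) = [(w.nextState q).val] := by
    intro q
    have h := List.ofFn_const (∏ a, (gameLasso k w).d q a) (w.nextState q).val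
    -- There is only one tuple of actions, so only one successor is listed.
    rw [show ∏ a, (gameLasso k w).d q a = 1 from Finset.prod_const_one] at h
    refine Eq.trans ?_ h
    refine List.ext_getElem (by simp) fun i _ _ => ?_
    simp
  simp only [hd, hδ]
  rw [encList_eq_encList_id, List.map_ofFn]
  rfl

/-! ### Runs of the machine on letters, words and lists of words -/

section Runs

variable {mid x : List Bool} {s : ℕ}

/-- The machine on a letter which is not the last one of the word. -/
theorem runs_letter {p : ℕ} (a : Finset (Fin p)) {n : ℕ} {t v f : Bool} {r o : List Bool}
    {l : List (Bool × Option Bool)} (hx : true :: (encLabel a ++ r) <:+ x)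
    (hr : v = true → ∃ r', r = true :: r') (hl : l.map Prod.fst = n.bits)
    (hs : (n + 1).bits.length + 1 < s) :
    (lassoMachine mid).RunsInSpace x s
      (lassoConfig mid x (.word t v f) (true :: (encLabel a ++ r)) 1 l o)
      (lassoConfig mid x (.word t v false) r 1 (incCounter v true l)
        (o ++ true :: lassoRow mid f a (n + 1))) := by
  have hx' := (List.suffix_cons _ _).trans hx
  have hfst : (incCounter v true l).map Prod.fst = (n + 1).bits := by
    rw [map_fst_incCounter, hl, addCarry_true_bits]
  have hlen : (incCounter v true l).length = (n + 1).bits.length := by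
    rw [← hfst, List.length_map]
  have hs1 : 1 < s := by omega
  have h₁ := (runs_read (o := o) (q := .word t v f) (q' := .label t v) (o' := [true, f])
    (mid := mid) (l := l) hx hs1 rfl).trans
    (runs_label (t := t) (v := v) (mid := mid) (l := l) _ hx' hs1)
  have h₂ : (lassoMachine mid).RunsInSpace x s
      (lassoConfig mid x (.word t v f) (true :: (encLabel a ++ r)) 1 l o)
      (lassoConfig mid x (.inc t v true) r 1 l
        (o ++ [true, f] ++ (encLabel a ++ (mid ++ [true])))) := by
    -- In `v` the machine first peeks at the next bit, which `hr` says is `true`; in `u` it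
    -- increments at once.
    cases v with
    | false => exact h₁
    | true =>
      obtain ⟨r', rfl⟩ := hr rfl
      have hi := inputAt_suffix ((List.suffix_append _ _).trans hx')
      have h := h₁.trans (runs_stay (q' := .inc t true true) (h' := 1) (l' := l)
        (w := counterTape l 1) (d := .stay) (o' := []) hs1 (by rw [hi]; rfl) rfl
        (Function.update_eq_self ..))
      rw [List.append_nil] at h
      exact h
  have h₃ := h₂.trans (runs_inc [] l (b := true) (by simpa [hlen] using hs))
  have hback := fun o => runs_back (mid := mid) (x := x) (s := s) (t := t) (v := v) (r := r)
    (o := o) (incCounter v true l) [] (by omega)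
  simp only [List.append_nil] at hback
  have h₄ := h₃.trans (hback _)
  simpa [lassoRow, hl, addCarry_true_bits, encList, encBool, encBinary] using h₄

/-- The machine on the last letter of a word. -/
theorem runs_last_letter {p : ℕ} (a : Finset (Fin p)) {m : ℕ} {t f : Bool} {r o : List Bool}
    {l : List (Bool × Option Bool)} (hx : true :: (encLabel a ++ false :: r) <:+ x)
    (hl : l.filterMap Prod.snd = m.bits) (hs : l.length + 1 < s) :
    (lassoMachine mid).RunsInSpace x s
      (lassoConfig mid x (.word t true f) (true :: (encLabel a ++ false :: r)) 1 l o)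
      (lassoConfig mid x (.list t) r 1 [] (o ++ true :: (lassoRow mid f a m ++ [false]))) := by
  have hx' := (List.suffix_cons _ _).trans hx
  have hs1 : 1 < s := by omega
  have h₁ := (runs_read (o := o) (q := .word t true f) (q' := .label t true) (o' := [true, f])
    (mid := mid) (l := l) hx hs1 rfl).trans
    (runs_label (t := t) (v := true) (mid := mid) (l := l) _ hx' hs1)
  have h₂ := h₁.trans (runs_read (q := .peek t) (q' := .flush t) (o' := [])
    ((List.suffix_append _ _).trans hx') hs1 rfl)
  have h₃ := h₂.trans (runs_flush [] l (by simpa using hs))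
  have h₄ := h₃.trans (runs_clear l (by omega))
  simpa [lassoRow, hl, encList, encBool, encBinary, encLabel] using h₄

/-- The machine on the first part of a word. -/
theorem runs_first_part {p : ℕ} (us : List (Finset (Fin p))) {n : ℕ} {t : Bool} {r o : List Bool}
    {l : List (Bool × Option Bool)} (hx : encList encLabel us ++ r <:+ x)
    (hn : n + (encList encLabel us ++ r).length ≤ x.length)
    (hs : ∀ i ≤ x.length, i.bits.length + 1 < s)
    (hfst : l.map Prod.fst = n.bits) (hsnd : l.filterMap Prod.snd = n.bits) :
    ∃ l' : List (Bool × Option Bool), l'.map Prod.fst = (n + us.length).bits ∧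
      l'.filterMap Prod.snd = (n + us.length).bits ∧ n + us.length + r.length ≤ x.length ∧
      (lassoMachine mid).RunsInSpace x s
        (lassoConfig mid x (.word t false (n == 0)) (encList encLabel us ++ r) 1 l o)
        (lassoConfig mid x (.word t true (n + us.length == 0)) r 1 l'
          (o ++ (us.mapIdx fun i a => lassoRow mid (i + n == 0) a (i + n + 1)).flatMap
            fun a => true :: a)) := by
  induction us generalizing n l o with
  | nil =>
    have h1 : 1 < s := lt_of_le_of_lt (by omega) (hs 0 (Nat.zero_le _))
    refine ⟨l, hfst, hsnd, ?_, runs_read hx h1 rfl⟩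
    simp only [encList, List.length_append, List.length_singleton] at hn
    simp only [List.length_nil]
    omega
  | cons a us ih =>
    have e : encList encLabel (a :: us) ++ r =
        true :: (encLabel a ++ (encList encLabel us ++ r)) := by simp [encList]
    rw [e] at hx hn ⊢
    simp only [List.length_cons, List.length_append] at hn
    have hx' := (List.suffix_append _ _).trans ((List.suffix_cons _ _).trans hx)
    have h₁ := runs_letter (mid := mid) (t := t) (v := false) (f := n == 0) (o := o) (s := s)
      a hx (by simp) hfst (hs _ (by omega))
    obtain ⟨l', h₂, h₃, h₄, h₅⟩ := ih (n := n + 1)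
      (o := o ++ true :: lassoRow mid (n == 0) a (n + 1)) (l := incCounter false true l) hx'
      (by simp only [List.length_append]; omega)
      (by rw [map_fst_incCounter, hfst, addCarry_true_bits])
      (by rw [filterMap_snd_incCounter_false, hfst, addCarry_true_bits])
    have e₂ : n + (a :: us).length = n + 1 + us.length := by simp only [List.length_cons]; omega
    rw [e₂]
    refine ⟨l', h₂, h₃, h₄, ?_⟩
    have h₆ := h₁.trans h₅
    have e₃ : ∀ i, i + (n + 1) = i + 1 + n := fun i => by omega
    simpa [List.mapIdx_cons, e₃] using h₆

/-- The machine on the second part of a word. -/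
theorem runs_second_part {p : ℕ} (vs : List (Finset (Fin p))) (hvs : vs ≠ []) {n m : ℕ} {t : Bool}
    {r o : List Bool} {l : List (Bool × Option Bool)} (hx : encList encLabel vs ++ r <:+ x)
    (hn : n + (encList encLabel vs ++ r).length ≤ x.length)
    (hs : ∀ i ≤ x.length, i.bits.length + 1 < s)
    (hfst : l.map Prod.fst = n.bits) (hsnd : l.filterMap Prod.snd = m.bits) :
    (lassoMachine mid).RunsInSpace x s
      (lassoConfig mid x (.word t true (n == 0)) (encList encLabel vs ++ r) 1 l o)
      (lassoConfig mid x (.list t) r 1 [] (o ++ encList id (vs.mapIdx fun i a =>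
        lassoRow mid (i + n == 0) a (if i + 1 < vs.length then i + n + 1 else m)))) := by
  induction vs generalizing n l o with
  | nil => exact absurd rfl hvs
  | cons a vs ih =>
    have e : encList encLabel (a :: vs) ++ r =
        true :: (encLabel a ++ (encList encLabel vs ++ r)) := by simp [encList]
    rw [e] at hx hn ⊢
    simp only [List.length_cons, List.length_append] at hn
    cases vs with
    | nil =>
      have hlen : l.length = n.bits.length := by rw [← hfst, List.length_map]
      have h := runs_last_letter (mid := mid) (t := t) (f := n == 0) (o := o) (s := s) (r := r)
        a hx hsnd (by rw [hlen]; exact hs _ (by omega))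
      simpa [encList] using h
    | cons b vs =>
      have hx' := (List.suffix_append _ _).trans ((List.suffix_cons _ _).trans hx)
      have h₁ := runs_letter (mid := mid) (t := t) (v := true) (f := n == 0) (o := o) (s := s)
        a hx (fun _ => ⟨_, rfl⟩) hfst (hs _ (by omega))
      have h₂ := ih (List.cons_ne_nil _ _) (n := n + 1)
        (o := o ++ true :: lassoRow mid (n == 0) a (n + 1)) (l := incCounter true true l) hx'
        (by simp only [List.length_append]; omega)
        (by rw [map_fst_incCounter, hfst, addCarry_true_bits])
        (by rw [filterMap_snd_incCounter_true, hsnd])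
      have h₃ := h₁.trans h₂
      have e₃ : ∀ i, i + (n + 1) = i + 1 + n := fun i => by omega
      rw [List.mapIdx_cons]
      simpa [encList, e₃] using h₃

theorem runs_word {p : ℕ} (w : UPWord p) {t : Bool} {r o : List Bool} (hx : w.enc ++ r <:+ x)
    (hs : ∀ i ≤ x.length, i.bits.length + 1 < s) :
    (lassoMachine mid).RunsInSpace x s
      (lassoConfig mid x (.word t false true) (w.enc ++ r) 1 [] o)
      (lassoConfig mid x (.list t) r 1 [] (o ++ encList id (lassoRows mid w))) := by
  rw [UPWord.enc, List.append_assoc] at hx ⊢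
  -- The empty counter stands for 0, and afterwards both tracks hold `|u|`. The invariant that
  -- letters read plus unread input fit in `|x|` keeps the counter logarithmic.
  obtain ⟨l, h₁, h₂, h₃, h₄⟩ := runs_first_part (mid := mid) (t := t) (o := o) (n := 0) (l := [])
    w.u hx (by simpa using hx.length_le) hs rfl rfl
  simp only [Nat.zero_add] at h₁ h₂ h₃ h₄
  have h₅ := h₄.trans (runs_second_part w.v w.v_ne_nil ((List.suffix_append _ _).trans hx)
    h₃ hs h₁ h₂)
  simpa [lassoRows, encList_append] using h₅

theorem runs_words {p : ℕ} (ws : List (UPWord p)) {t : Bool} {r o : List Bool}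
    (hx : encList UPWord.enc ws ++ r <:+ x) (hs : ∀ i ≤ x.length, i.bits.length + 1 < s) :
    (lassoMachine mid).RunsInSpace x s
      (lassoConfig mid x (.list t) (encList UPWord.enc ws ++ r) 1 [] o)
      (lassoConfig mid x (if t then .copy else .list true) r 1 []
        (o ++ encList (fun w => encList id (lassoRows mid w)) ws)) := by
  have h1 : 1 < s := lt_of_le_of_lt (by omega) (hs 0 (Nat.zero_le _))
  induction ws generalizing o with
  | nil => exact runs_read hx h1 rfl
  | cons w ws ih =>
    have e : encList UPWord.enc (w :: ws) ++ r =
        true :: (w.enc ++ (encList UPWord.enc ws ++ r)) := by simp [encList]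
    rw [e] at hx ⊢
    have hx' := (List.suffix_cons _ _).trans hx
    have h := ((runs_read (q := .list t) (q' := .word t false true) (o' := [true]) (o := o)
      (mid := mid) (l := []) hx h1 rfl).trans (runs_word w hx' hs)).trans
      (ih ((List.suffix_append _ _).trans hx'))
    simpa [encList] using h

theorem runs_copy (r : List Bool) {h : ℕ} {l : List (Bool × Option Bool)} {o : List Bool}
    (hx : r <:+ x) (hs : h < s) :
    (lassoMachine mid).RunsInSpace x s (lassoConfig mid x .copy r h l o)
      (lassoConfig mid x .copy [] h l (o ++ r)) := by
  induction r generalizing o with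
  | nil =>
    rw [List.append_nil]
    exact Relation.ReflTransGen.refl
  | cons b r ih =>
    have h := (runs_read (q := .copy) (q' := .copy) (o' := [b]) (o := o) (mid := mid) (l := l)
      hx hs rfl).trans (ih ((List.suffix_cons _ _).trans hx))
    simpa using h

theorem runs_start (hs : 0 < s) :
    (lassoMachine mid).RunsInSpace x s (lassoMachine mid).initial
      (lassoConfig mid x .unary x 1 [] []) := by
  refine Relation.ReflTransGen.single ⟨?_, fun _ => hs⟩
  have e : Function.update (fun _ => Cell.blank) 0 Cell.marker = counterTape [] := by
    funext i
    cases i <;> simp [counterTape]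
  simp [Transducer.next, Transducer.initial, lassoMachine, lassoStep, lassoConfig, Dir.move, e]

end Runs

/-- The machine writes the instance where each word is replaced by the table of its lasso. -/
theorem lassoMachine_computesInSpace (mid : List Bool) (I : LearnInst UPWord) :
    (lassoMachine mid).ComputesInSpace (LearnInst.enc (fun _ => UPWord.enc) I)
      (encUnary I.numProp ++ (encList (fun w => encList id (lassoRows mid w)) I.pos ++
        (encList (fun w => encList id (lassoRows mid w)) I.neg ++ encUnary I.bound)))
      (3 * (Nat.log 2 (LearnInst.enc (fun _ => UPWord.enc) I).length + 1)) := by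
  -- A counter up to `|x|` has at most `log |x| + 1` digits, and one more cell on each side is
  -- visited. The factor 3 gives `log |x| + 2 < 3 (log |x| + 1)` with no lower bound on `|x|`.
  have hs : ∀ i ≤ (LearnInst.enc (fun _ => UPWord.enc) I).length, i.bits.length + 1 <
      3 * (Nat.log 2 (LearnInst.enc (fun _ => UPWord.enc) I).length + 1) := fun i hi => by
    have := length_bits_le_log i _ hi
    omega
  generalize hx : LearnInst.enc (fun _ => UPWord.enc) I = x at hs ⊢
  generalize 3 * (Nat.log 2 x.length + 1) = s at hs ⊢
  have h1 : 1 < s := lt_of_le_of_lt (by omega) (hs 0 (Nat.zero_le _))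
  have hx₀ : encUnary I.numProp ++ (encList UPWord.enc I.pos ++ (encList UPWord.enc I.neg ++
      encUnary I.bound)) <:+ x := by rw [← hx]; exact List.suffix_refl _
  have hx₁ := (List.suffix_append _ _).trans hx₀
  have hx₂ := (List.suffix_append _ _).trans hx₁
  have hx₃ := (List.suffix_append _ _).trans hx₂
  have h₀ := runs_start (mid := mid) (x := x) (s := s) (by omega)
  have e : x = encUnary I.numProp ++ (encList UPWord.enc I.pos ++ (encList UPWord.enc I.neg ++
      encUnary I.bound)) := hx.symm
  have h := (((runs_unary (mid := mid) (l := []) (o := []) _ hx₀ h1).trans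
    (runs_words (mid := mid) (t := false) _ hx₁ hs)).trans
    (runs_words (mid := mid) (t := true) _ hx₂ hs)).trans (runs_copy _ hx₃ h1)
  rw [← e] at h
  -- The machine halts since `copy` has no transition on the right end marker.
  have h' := (h₀.trans h).computesInSpace (by
    have hi := inputAt_suffix (List.nil_suffix (l := x))
    simp only [Transducer.next, lassoConfig, lassoMachine]
    rw [hi]
    rfl) (fun _ => h1)
  simpa [lassoConfig] using h'

/-! ### The two reductions -/

theorem isLogspaceReduction_toLassos (Ut : Set UnOp) (Bt : Set TempBin) (Bl : Set LogBin)
    (n : ℕ∞) :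
    IsLogspaceReduction (LTLLearn Ut Bt Bl n) (CTLLearn Ut Bt Bl n) LearnInst.toLassos := by
  -- The inserted quantifier is arbitrary: `.all` here, the empty coalition for ATL.
  refine ⟨fun I => exists_separating_iff .all Kripke.Models lasso models_lasso_iff
    Ut Bt Bl n I.pos I.neg I.bound, lassoMachine [], 3, fun I => ?_⟩
  have h := lassoMachine_computesInSpace [] I
  simp only [← enc_lasso, ← encList_map Kripke.enc lasso] at h
  exact h

theorem isLogspaceReduction_toGameLassos (k : ℕ) (Ut : Set UnOp) (Bt : Set TempBin)
    (Bl : Set LogBin) (n : ℕ∞) :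
    IsLogspaceReduction (LTLLearn Ut Bt Bl n) (ATLLearn k Ut Bt Bl n)
      (LearnInst.toGameLassos k) := by
  refine ⟨fun I => exists_separating_iff ∅ CGS.Models (gameLasso k) models_gameLasso_iff
    Ut Bt Bl n I.pos I.neg I.bound, lassoMachine (encList encUnary (List.replicate k 1)), 3,
    fun I => ?_⟩
  have h := lassoMachine_computesInSpace (encList encUnary (List.replicate k 1)) I
  simp only [← enc_gameLasso, ← encList_map CGS.enc (gameLasso k)] at h
  exact h

end LearnTL

theorem mainTheorem2 (Ut : Set LearnTL.UnOp) (Bt : Set LearnTL.TempBin)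
    (Bl : Set LearnTL.LogBin) (n : ℕ∞) :
    LearnTL.IsLogspaceReduction (LearnTL.LTLLearn Ut Bt Bl n) (LearnTL.CTLLearn Ut Bt Bl n)
        LearnTL.LearnInst.toLassos ∧
      ∀ k : ℕ, 1 ≤ k →
        LearnTL.LogspaceReducible (LearnTL.LTLLearn Ut Bt Bl n)
          (LearnTL.ATLLearn k Ut Bt Bl n) :=
  ⟨LearnTL.isLogspaceReduction_toLassos Ut Bt Bl n, fun k _ =>
    ⟨_, LearnTL.isLogspaceReduction_toGameLassos k Ut Bt Bl n⟩⟩
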